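/- Let $P$ be a complex polynomial in $d$ variables and let $1\le p\le\infty$. Write $P(\partial)$ for the constant-coefficient differential operator obtained by substituting $\partial_j=\partial/\partial x_j$ for the $j$-th variable; it acts on tempered distributions on $\mathbb R^d$, and $P(\partial)e^{i\lambda\cdot x}=P(i\lambda)e^{i\lambda\cdot x}$. Let $\mathcal F$ be the Fourier transform on tempered distributions, defined by $\langle \mathcal F T,\varphi\rangle=\langle T,\mathcal F\varphi\rangle$ with $\mathcal F\varphi(\lambda)=(2\pi)^{-d/2}\int_{\mathbb R^d}\varphi(x)e^{-i\lambda\cdot x}\,dx$ for Schwartz functions $\varphi$. For a tempered distribution $T$ put $$R(P,T)=\sup\{|P(i\lambda)|:\lambda\in\operatorname{supp}T\}\in[0,\infty],$$ with $R(P,0)=0$. Suppose that $f$ is a tempered distribution on $\mathbb R^d$ such that, for all $n\ge 0$, the distribution $P(\partial)^nf$ is (given by) a function in $L^p(\mathbb R^d)$; in particular $f\in L^p(\mathbb R^d)$. Assume furthermore that either $\mathcal F f$ has compact support, or the set $\{\lambda\in\mathbb R^d:|P(i\lambda)|\le R\}$ is compact for every $R\ge 0$. Then, in the extended non-negative real numbers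 $[0,\infty]$, $$\lim_{n\to\infty}\|P(\partial)^nf\|_p^{1/n}=R(P,\mathcal F f).$$ -/

import Mathlib

open MeasureTheory Filter Topology
open scoped SchwartzMap LineDeriv ENNReal FourierTransform

namespace RealPaleyWiener

/-- The Euclidean space `ℝ^d`. -/
abbrev Space (d : ℕ) : Type := EuclideanSpace ℝ (Fin d)

/-- The monomial operator `∂^m = ∂_1^{m_1} ⋯ ∂_d^{m_d}` on tempered distributions. -/
noncomputable def monomialDeriv {d : ℕ} (m : Fin d →₀ ℕ) : 𝓢'(Space d, ℂ) →L[ℂ] 𝓢'(Space d, ℂ) :=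
  ((List.finRange d).map fun j =>
    (LineDeriv.lineDerivOpCLM ℂ 𝓢'(Space d, ℂ) (EuclideanSpace.single j (1 : ℝ))) ^ m j).prod

/-- The constant coefficient differential operator `P(∂)` on tempered distributions. -/
noncomputable def diffOp {d : ℕ} (P : MvPolynomial (Fin d) ℂ) :
    𝓢'(Space d, ℂ) →L[ℂ] 𝓢'(Space d, ℂ) :=
  ∑ m ∈ P.support, P.coeff m • monomialDeriv m

/-- The value `P(iξ)` for `ξ ∈ ℝ^d`. -/
noncomputable def symbol {d : ℕ} (P : MvPolynomial (Fin d) ℂ) (ξ : Space d) : ℂ :=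
  MvPolynomial.eval (fun j => Complex.I * (ξ j : ℂ)) P

/-- The dilation `ξ ↦ (2π)⁻¹ ξ` of `ℝ^d`. -/
noncomputable def dilation (d : ℕ) : Space d ≃L[ℝ] Space d :=
  ContinuousLinearEquiv.smulLeft (Units.mk0 ((2 * Real.pi)⁻¹ : ℝ) (by positivity))

/-- The Fourier transform on Schwartz functions with the normalization
`(2π)^{-d/2} ∫ φ(x) e^{-i ξ·x} dx`; see `fourierSchwartz_apply`. -/
noncomputable def fourierSchwartz (d : ℕ) : 𝓢(Space d, ℂ) →L[ℂ] 𝓢(Space d, ℂ) :=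
  (((2 * Real.pi) ^ (-(d : ℝ) / 2) : ℝ) : ℂ) •
    (SchwartzMap.compCLMOfContinuousLinearEquiv ℂ (dilation d)).comp
      (FourierTransform.fourierCLM ℂ 𝓢(Space d, ℂ))

theorem fourierSchwartz_apply {d : ℕ} (φ : 𝓢(Space d, ℂ)) (ξ : Space d) :
    fourierSchwartz d φ ξ = (((2 * Real.pi) ^ (-(d : ℝ) / 2) : ℝ) : ℂ) *
      ∫ x : Space d, φ x * Complex.exp (-Complex.I * ((∑ j, ξ j * x j : ℝ) : ℂ)) := by
  have h : fourierSchwartz d φ ξ = (((2 * Real.pi) ^ (-(d : ℝ) / 2) : ℝ) : ℂ) *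
      𝓕 (φ : Space d → ℂ) ((2 * Real.pi)⁻¹ • ξ) := rfl
  rw [h, Real.fourier_eq']
  congr 1
  apply integral_congr_ae
  refine Eventually.of_forall fun x => ?_
  have hπ : (Real.pi : ℂ) ≠ 0 := by exact_mod_cast Real.pi_ne_zero
  simp only [smul_eq_mul, inner_smul_right, PiLp.inner_apply]
  rw [mul_comm]
  congr 2
  push_cast
  simp
  field_simp

/-- The Fourier transform of a tempered distribution, `⟨𝓕 T, φ⟩ = ⟨T, 𝓕 φ⟩`. -/
noncomputable def fourierDist {d : ℕ} (T : 𝓢'(Space d, ℂ)) : 𝓢'(Space d, ℂ) :=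
  PointwiseConvergenceCLM.precomp ℂ (fourierSchwartz d) T

theorem fourierDist_apply {d : ℕ} (T : 𝓢'(Space d, ℂ)) (φ : 𝓢(Space d, ℂ)) :
    fourierDist T φ = T (fourierSchwartz d φ) := rfl

/-- `R(P,T) = sup {|P(iξ)| : ξ ∈ supp T}` in `[0,∞]`; it is `0` if `T` has empty support. -/
noncomputable def supRadius {d : ℕ} (P : MvPolynomial (Fin d) ℂ) (T : 𝓢'(Space d, ℂ)) : ℝ≥0∞ :=
  ⨆ ξ ∈ Distribution.dsupport T, ‖symbol P ξ‖ₑ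

end RealPaleyWiener

/-! The limit is squeezed between two estimates, both resting on one fact: if `‖u‖ ≤ M` on the
support of a compactly supported `χ`, every Schwartz seminorm of `u ^ n * χ` is `O((M + ε) ^ n)`,
because differentiating a power costs only a factor independent of `n`
(`exists_seminorm_pow_mul_le`). On the Fourier side `P(∂)` is multiplication by `symbol P`.

Lower bound (`exists_norm_fourierDist_le`): near a support point with `|P(iξ)| > ρ`, pick a test
function `φ` on which `𝓕 f` does not vanish. Writing `φ = P ^ n * (P⁻ⁿ φ)` moves `P ^ n` onto `f`;
Hölder then bounds the fixed number `|⟨𝓕 f, φ⟩|` by `‖P(∂)^n f‖_p` times a norm of the transform of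
`P⁻ⁿ φ`, which grows barely faster than `ρ⁻ⁿ`.

Upper bound (`exists_norm_le_of_norm_symbol_lt`): if the support is compact and `|P(iξ)| < M` there,
take a cutoff `χ` equal to 1 near it. Then `P(∂)^n f` is the correlation of `f` with the transform
of `P ^ n * χ`, whose `L¹` norm is `O(r ^ n)` for any `r > M`, and Young's inequality applies. If
instead the sublevel sets of the symbol are compact, a finite `R(P, 𝓕 f)` forces the support to be
compact. -/

namespace RealPaleyWiener

/-! ### Growth in `n` of the Schwartz seminorms of `u ^ n * χ`. -/

section PowerBounds

variable {E : Type*} [NormedAddCommGroup E] [NormedSpace ℝ E]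

/-- Induction on `n` by Leibniz. The term with no derivative on the last factor contributes `M`. In
every other term at most `i - 1` derivatives fall on the power, so one factor `L` is spare, and `2 ^
N * B ≤ ε * L` turns their sum into the contribution `ε`. -/
theorem norm_iteratedFDeriv_pow_le {u : E → ℂ} (hu : ContDiff ℝ (⊤ : ℕ∞) u) {x : E}
    {M B ε L : ℝ} {N : ℕ} (hM : ‖u x‖ ≤ M) (hB : ∀ i ≤ N, ‖iteratedFDeriv ℝ i u x‖ ≤ B)
    (hε : 0 < ε) (hL : 1 ≤ L) (hBL : 2 ^ N * B ≤ ε * L) (n : ℕ) :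
    ∀ i ≤ N, ‖iteratedFDeriv ℝ i (fun y => u y ^ n) x‖ ≤ L ^ i * (M + ε) ^ n := by
  have hM0 : 0 ≤ M := (norm_nonneg _).trans hM
  have hB0 : 0 ≤ B := (norm_nonneg _).trans (hB 0 (Nat.zero_le _))
  induction n with
  | zero =>
    intro i _
    rcases Nat.eq_zero_or_pos i with rfl | hi
    · simp
    · simp only [pow_zero]
      rw [iteratedFDeriv_const_of_ne hi.ne']
      simp; positivity
  | succ n ih =>
    intro i hi
    simp only [pow_succ]
    refine (norm_iteratedFDeriv_mul_le (n := i) (N := (⊤ : ℕ∞)) (hu.pow n) hu x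
      (by exact_mod_cast le_top)).trans ?_
    rw [Finset.sum_range_succ]
    have h1 : ∑ j ∈ Finset.range i, (i.choose j : ℝ) * ‖iteratedFDeriv ℝ j (fun y => u y ^ n) x‖ *
        ‖iteratedFDeriv ℝ (i - j) u x‖ ≤ L ^ i * (M + ε) ^ n * ε := by
      rcases Nat.eq_zero_or_pos i with rfl | hi0
      · simp; positivity
      calc _ ≤ ∑ j ∈ Finset.range i, (i.choose j : ℝ) * (L ^ (i - 1) * (M + ε) ^ n) * B := by
            refine Finset.sum_le_sum fun j hj => ?_
            have hj' := Finset.mem_range.1 hj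
            gcongr
            · refine (ih j (by omega)).trans ?_
              gcongr ?_ * _
              exact pow_le_pow_right₀ hL (by omega)
            · exact hB _ (by omega)
        _ = (∑ j ∈ Finset.range i, (i.choose j : ℝ)) * ((L ^ (i - 1) * (M + ε) ^ n) * B) := by
            rw [Finset.sum_mul]
            exact Finset.sum_congr rfl fun j _ => by ring
        _ ≤ 2 ^ N * ((L ^ (i - 1) * (M + ε) ^ n) * B) := by
            gcongr
            calc (∑ j ∈ Finset.range i, (i.choose j : ℝ))
                ≤ ∑ j ∈ Finset.range (i + 1), (i.choose j : ℝ) := by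
                  rw [Finset.sum_range_succ]; simp
              _ = 2 ^ i := by exact_mod_cast Nat.sum_range_choose i
              _ ≤ 2 ^ N := pow_le_pow_right₀ one_le_two hi
        _ = (L ^ (i - 1) * (M + ε) ^ n) * (2 ^ N * B) := by ring
        _ ≤ (L ^ (i - 1) * (M + ε) ^ n) * (ε * L) := by gcongr
        _ = (L ^ (i - 1) * L) * (M + ε) ^ n * ε := by ring
        _ = _ := by rw [← pow_succ, Nat.sub_add_cancel hi0]
    have h2 : (i.choose i : ℝ) * ‖iteratedFDeriv ℝ i (fun y => u y ^ n) x‖ *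
        ‖iteratedFDeriv ℝ (i - i) u x‖ ≤ L ^ i * (M + ε) ^ n * M := by
      rw [Nat.choose_self, Nat.cast_one, one_mul, Nat.sub_self, norm_iteratedFDeriv_zero]
      gcongr
      exact ih i hi
    calc _ ≤ L ^ i * (M + ε) ^ n * ε + L ^ i * (M + ε) ^ n * M := add_le_add h1 h2
      _ = _ := by ring

theorem exists_seminorm_pow_mul_le {u : E → ℂ} (hu : ContDiff ℝ (⊤ : ℕ∞) u) {χ : 𝓢(E, ℂ)}
    (hχ : HasCompactSupport χ) {M ε : ℝ} (hM0 : 0 ≤ M) (hM : ∀ x ∈ tsupport χ, ‖u x‖ ≤ M)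
    (hε : 0 < ε)
    {w : ℕ → 𝓢(E, ℂ)} (hw : ∀ n x, w n x = u x ^ n * χ x) (k l : ℕ) :
    ∃ C, 0 ≤ C ∧ ∀ n, SchwartzMap.seminorm ℂ k l (w n) ≤ C * (M + ε) ^ n := by
  have hb : ∀ i, ∃ B, 0 ≤ B ∧ ∀ x ∈ tsupport χ, ‖iteratedFDeriv ℝ i u x‖ ≤ B := fun i => by
    obtain ⟨B, hB⟩ := hχ.isCompact.exists_bound_of_continuousOn
      (hu.continuous_iteratedFDeriv (m := i) (by exact_mod_cast le_top)).continuousOn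
    exact ⟨max B 0, le_max_right _ _, fun x hx => (hB x hx).trans (le_max_left _ _)⟩
  choose b hb0 hb using hb
  set B := ∑ i ∈ Finset.range (l + 1), b i
  have hB : ∀ x ∈ tsupport χ, ∀ i ≤ l, ‖iteratedFDeriv ℝ i u x‖ ≤ B := fun x hx i hi =>
    (hb i x hx).trans (Finset.single_le_sum (f := b) (fun j _ => hb0 j)
      (Finset.mem_range.2 (by omega)))
  have hB0 : 0 ≤ B := Finset.sum_nonneg fun i _ => hb0 i
  -- The least `L` meeting both requirements of the power bound; it does not depend on `n`.
  set L := max 1 (2 ^ l * B / ε)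
  have hL : 1 ≤ L := le_max_left _ _
  have hBL : 2 ^ l * B ≤ ε * L := by
    rw [← div_le_iff₀' hε]; exact le_max_right _ _
  refine ⟨∑ j ∈ Finset.range (l + 1),
    (l.choose j : ℝ) * L ^ j * SchwartzMap.seminorm ℂ k (l - j) χ,
    Finset.sum_nonneg fun j _ => by positivity, fun n => ?_⟩
  refine SchwartzMap.seminorm_le_bound ℂ k l _ (mul_nonneg
    (Finset.sum_nonneg fun j _ => by positivity) (by positivity)) fun x => ?_
  have hwn : (w n : E → ℂ) = fun y => u y ^ n * χ y := funext (hw n)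
  rw [hwn]
  by_cases hx : x ∈ tsupport χ
  · calc _ ≤ ‖x‖ ^ k * ∑ j ∈ Finset.range (l + 1), (l.choose j : ℝ) *
          ‖iteratedFDeriv ℝ j (fun y => u y ^ n) x‖ * ‖iteratedFDeriv ℝ (l - j) χ x‖ := by
          gcongr
          exact norm_iteratedFDeriv_mul_le (N := (⊤ : ℕ∞)) (hu.pow n) (χ.smooth _) x
            (by exact_mod_cast le_top)
      _ = ∑ j ∈ Finset.range (l + 1), (l.choose j : ℝ) *
          ‖iteratedFDeriv ℝ j (fun y => u y ^ n) x‖ *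
            (‖x‖ ^ k * ‖iteratedFDeriv ℝ (l - j) χ x‖) := by
          rw [Finset.mul_sum]
          exact Finset.sum_congr rfl fun j _ => by ring
      _ ≤ ∑ j ∈ Finset.range (l + 1), (l.choose j : ℝ) * (L ^ j * (M + ε) ^ n) *
            SchwartzMap.seminorm ℂ k (l - j) χ := by
          refine Finset.sum_le_sum fun j hj => ?_
          have hj' := Finset.mem_range.1 hj
          gcongr
          · exact norm_iteratedFDeriv_pow_le hu (hM x hx) (hB x hx) hε hL hBL n j (by omega)
          · exact SchwartzMap.le_seminorm ℂ k (l - j) χ x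
      _ = _ := by
          rw [Finset.sum_mul]
          exact Finset.sum_congr rfl fun j _ => by ring
  · have h0 : iteratedFDeriv ℝ l (fun y => u y ^ n * χ y) x = 0 := by
      by_contra h
      exact hx ((closure_mono (Function.support_mul_subset_right _ _))
        (support_iteratedFDeriv_subset l h))
    rw [h0, norm_zero, mul_zero]
    exact mul_nonneg (Finset.sum_nonneg fun j _ => by positivity) (by positivity)

/-- A continuous linear map into a normed space is controlled by finitely many Schwartz seminorms.
It is applied with Fourier-type transforms followed by the inclusion into some `L^q`. -/
theorem exists_norm_clm_pow_mul_le {Y : Type*} [NormedAddCommGroup Y] [NormedSpace ℂ Y]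
    (A : 𝓢(E, ℂ) →L[ℂ] Y) {u : E → ℂ} (hu : ContDiff ℝ (⊤ : ℕ∞) u) {χ : 𝓢(E, ℂ)}
    (hχ : HasCompactSupport χ) {M ε : ℝ} (hM0 : 0 ≤ M) (hM : ∀ x ∈ tsupport χ, ‖u x‖ ≤ M)
    (hε : 0 < ε) {w : ℕ → 𝓢(E, ℂ)} (hw : ∀ n x, w n x = u x ^ n * χ x) :
    ∃ C, 0 ≤ C ∧ ∀ n, ‖A (w n)‖ ≤ C * (M + ε) ^ n := by
  obtain ⟨s, C, -, hC⟩ := Seminorm.bound_of_continuous (schwartz_withSeminorms ℂ E ℂ)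
    ((normSeminorm ℂ Y).comp A.toLinearMap) (continuous_norm.comp A.continuous)
  choose D hD0 hD using fun m : ℕ × ℕ =>
    exists_seminorm_pow_mul_le hu hχ hM0 hM hε hw m.1 m.2
  refine ⟨C * ∑ m ∈ s, D m, mul_nonneg C.2 (Finset.sum_nonneg fun m _ => hD0 m), fun n => ?_⟩
  calc ‖A (w n)‖ ≤ (C • s.sup (schwartzSeminormFamily ℂ E ℂ)) (w n) := hC (w n)
    _ = C * s.sup (schwartzSeminormFamily ℂ E ℂ) (w n) := rfl
    _ ≤ C * ∑ m ∈ s, schwartzSeminormFamily ℂ E ℂ m (w n) := by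
        gcongr
        exact (Seminorm.finset_sup_le_sum _ s (w n)).trans_eq (by simp)
    _ ≤ C * ∑ m ∈ s, D m * (M + ε) ^ n := by
        gcongr with m
        exact hD m n
    _ = _ := by rw [← Finset.sum_mul, mul_assoc]

end PowerBounds

/-! ### Young's inequality and correlation with a Schwartz kernel. -/

section Convolution

variable {E : Type*} [NormedAddCommGroup E] [InnerProductSpace ℝ E] [FiniteDimensional ℝ E]
  [MeasurableSpace E] [BorelSpace E]

theorem measurable_prod_sub_mul {A B : E → ℝ≥0∞} (hA : Measurable A) (hB : Measurable B) :
    Measurable fun z : E × E => A (z.2 - z.1) * B z.2 :=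
  (hA.comp (measurable_snd.sub measurable_fst)).mul (hB.comp measurable_snd)

theorem measurable_lintegral_sub_mul {A B : E → ℝ≥0∞} (hA : Measurable A) (hB : Measurable B) :
    Measurable fun y => ∫⁻ x, A (x - y) * B x :=
  (measurable_prod_sub_mul hA hB).lintegral_prod_right'

/-- Hölder for the splitting `A B = A ^ (1 - 1/r) * (A B ^ r) ^ (1/r)` gives a pointwise bound;
Tonelli and translation invariance then integrate it. -/
theorem lintegral_rpow_lintegral_sub_mul_le {A B : E → ℝ≥0∞} (hA : Measurable A)
    (hB : Measurable B) {r : ℝ} (hr : 1 ≤ r) :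
    ∫⁻ y, (∫⁻ x, A (x - y) * B x) ^ r ≤ (∫⁻ x, A x) ^ r * ∫⁻ x, B x ^ r := by
  have hr0 : 0 < r := by linarith
  have hpt : ∀ y, (∫⁻ x, A (x - y) * B x) ^ r ≤
      (∫⁻ x, A x) ^ (r - 1) * ∫⁻ x, A (x - y) * B x ^ r := fun y => by
    have h := ENNReal.lintegral_mul_norm_pow_le (μ := (volume : Measure E))
      (f := fun x => A (x - y)) (g := fun x => A (x - y) * B x ^ r)
      (hA.comp (measurable_id.sub_const y)).aemeasurable
      ((hA.comp (measurable_id.sub_const y)).mul (hB.pow_const r)).aemeasurable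
      (p := 1 - 1 / r) (q := 1 / r)
      (by rw [sub_nonneg, div_le_one hr0]; exact hr) (by positivity) (by ring)
    have heq : ∀ x, A (x - y) ^ (1 - 1 / r) * (A (x - y) * B x ^ r) ^ (1 / r) =
        A (x - y) * B x := fun x => by
      rw [ENNReal.mul_rpow_of_nonneg _ _ (by positivity), ← mul_assoc,
        ← ENNReal.rpow_add_of_nonneg _ _
          (by rw [sub_nonneg, div_le_one hr0]; exact hr) (by positivity),
        ← ENNReal.rpow_mul, mul_one_div_cancel hr0.ne']
      simp
    simp_rw [heq] at h
    rw [lintegral_sub_right_eq_self A y] at h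
    calc _ ≤ _ := ENNReal.rpow_le_rpow h hr0.le
      _ = _ := by
        rw [ENNReal.mul_rpow_of_nonneg _ _ hr0.le, ← ENNReal.rpow_mul, ← ENNReal.rpow_mul,
          one_div_mul_cancel hr0.ne', ENNReal.rpow_one, sub_mul, one_div_mul_cancel hr0.ne',
          one_mul]
  calc _ ≤ ∫⁻ y, (∫⁻ x, A x) ^ (r - 1) * ∫⁻ x, A (x - y) * B x ^ r := lintegral_mono hpt
    _ = (∫⁻ x, A x) ^ (r - 1) * ∫⁻ y, ∫⁻ x, A (x - y) * B x ^ r :=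
        lintegral_const_mul _ (measurable_lintegral_sub_mul hA (hB.pow_const r))
    _ = (∫⁻ x, A x) ^ (r - 1) * ∫⁻ x, ∫⁻ y, A (x - y) * B x ^ r := by
        rw [lintegral_lintegral_swap]
        exact (measurable_prod_sub_mul hA (hB.pow_const r)).aemeasurable
    _ = (∫⁻ x, A x) ^ (r - 1) * ∫⁻ x, (∫⁻ y, A y) * B x ^ r := by
        congr 1
        refine lintegral_congr fun x => ?_
        have hm : Measurable fun y => A (x - y) := hA.comp (measurable_id.const_sub x)
        rw [lintegral_mul_const _ hm, lintegral_sub_left_eq_self A x]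
    _ = (∫⁻ x, A x) ^ (r - 1) * ((∫⁻ y, A y) ^ (1 : ℝ) * ∫⁻ x, B x ^ r) := by
        rw [lintegral_const_mul _ (hB.pow_const r), ENNReal.rpow_one]
    _ = _ := by
        rw [← mul_assoc, ← ENNReal.rpow_add_of_nonneg _ _ (by linarith) zero_le_one,
          sub_add_cancel]

/-- Young's inequality `L¹ * Lᵖ ⊆ Lᵖ` for nonnegative functions. -/
theorem eLpNorm_lintegral_sub_mul_le {A B : E → ℝ≥0∞} (hA : Measurable A) (hB : Measurable B)
    {p : ℝ≥0∞} (hp : 1 ≤ p) :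
    eLpNorm (fun y => ∫⁻ x, A (x - y) * B x) p volume ≤ (∫⁻ x, A x) * eLpNorm B p volume := by
  have hp0 : p ≠ 0 := (zero_lt_one.trans_le hp).ne'
  rcases eq_or_ne p ∞ with rfl | hpt
  · simp only [eLpNorm_exponent_top]
    refine eLpNormEssSup_le_of_ae_enorm_bound (Eventually.of_forall fun y => ?_)
    calc (∫⁻ x, A (x - y) * B x)
        ≤ ∫⁻ x, A (x - y) * eLpNormEssSup B volume := by
          refine lintegral_mono_ae ?_
          filter_upwards [enorm_ae_le_eLpNormEssSup B volume] with x hx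
          gcongr
          exact hx
      _ = _ := by
          have hm : Measurable fun x => A (x - y) := hA.comp (measurable_id.sub_const y)
          rw [lintegral_mul_const _ hm, lintegral_sub_right_eq_self A y]
  · have hr : 1 ≤ p.toReal := by
      rw [← ENNReal.toReal_one]; exact ENNReal.toReal_mono hpt hp
    have hr0 : 0 < p.toReal := by linarith
    rw [eLpNorm_eq_lintegral_rpow_enorm_toReal hp0 hpt,
      eLpNorm_eq_lintegral_rpow_enorm_toReal hp0 hpt]
    simp only [enorm_eq_self]
    calc _ ≤ _ := ENNReal.rpow_le_rpow (lintegral_rpow_lintegral_sub_mul_le hA hB hr)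
          (by positivity : 0 ≤ 1 / p.toReal)
      _ = _ := by
        rw [ENNReal.mul_rpow_of_nonneg _ _ (by positivity), ← ENNReal.rpow_mul,
          mul_one_div_cancel hr0.ne', ENNReal.rpow_one]

theorem integrable_mul_prod {φ : E → ℂ} {F : E × E → ℂ} {G : E → ℝ≥0∞} (hφ : StronglyMeasurable φ)
    (hF : StronglyMeasurable F) (hFG : ∀ y, ∫⁻ x, ‖F (y, x)‖ₑ ≤ G y) (hG : ∀ y, G y < ∞)
    (hint : Integrable fun y => φ y * ((G y).toReal : ℂ)) :
    Integrable (fun z : E × E => φ z.1 * F z) ((volume : Measure E).prod volume) := by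
  have hm : StronglyMeasurable fun z : E × E => φ z.1 * F z :=
    (hφ.comp_measurable measurable_fst).mul hF
  refine ⟨hm.aestronglyMeasurable, ?_⟩
  have h2 := hint.2
  rw [hasFiniteIntegral_iff_enorm] at h2 ⊢
  rw [lintegral_prod _ hm.measurable.enorm.aemeasurable]
  refine lt_of_le_of_lt (lintegral_mono fun y => ?_) h2
  have hmy : Measurable fun x => ‖F (y, x)‖ₑ := hF.measurable.enorm.comp measurable_prodMk_left
  have he : ‖((G y).toReal : ℂ)‖ₑ = G y := by
    rw [← ofReal_norm, Complex.norm_real, Real.norm_of_nonneg ENNReal.toReal_nonneg,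
      ENNReal.ofReal_toReal (hG y).ne]
  simp only [enorm_mul]
  rw [lintegral_const_mul _ hmy, he]
  gcongr
  exact hFG y

/-- If `g` is, as a distribution, the correlation of `f ∈ Lᵖ` with a Schwartz kernel `k`, then
`‖g‖_p ≤ ‖k‖_1 ‖f‖_p`. -/
theorem eLpNorm_le_of_forall_integral_eq {p : ℝ≥0∞} [hp : Fact (1 ≤ p)] (k : 𝓢(E, ℂ))
    (f g : Lp ℂ p (volume : Measure E))
    (h : ∀ φ : 𝓢(E, ℂ), Lp.toTemperedDistribution g φ = ∫ x, (∫ y, k (x - y) * φ y) * f x) :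
    eLpNorm g p volume ≤ (∫⁻ x, ‖k x‖ₑ) * eLpNorm f p volume := by
  have hq := ENNReal.HolderConjugate.inv_one_sub_inv' hp.out
  have hfm : Measurable f := (Lp.stronglyMeasurable f).measurable
  have hkm : Measurable fun x => ‖k x‖ₑ := k.continuous.measurable.enorm
  set H : E → ℝ≥0∞ := fun y => ∫⁻ x, ‖k (x - y)‖ₑ * ‖f x‖ₑ
  set F : E → ℂ := fun y => ∫ x, k (x - y) * f x
  have hHm : Measurable H := measurable_lintegral_sub_mul hkm hfm.enorm
  have hyoung : eLpNorm H p volume ≤ (∫⁻ x, ‖k x‖ₑ) * eLpNorm f p volume := by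
    refine (eLpNorm_lintegral_sub_mul_le hkm hfm.enorm hp.out).trans_eq ?_
    rw [eLpNorm_enorm]
  -- Finite at every `y`, not merely almost everywhere: a translate of `k` lies in the conjugate
  -- space of `L^p`.
  have hHtop : ∀ y, H y < ∞ := fun y => by
    have h1 : Integrable (fun x => SchwartzMap.compSubConstCLM ℂ y k x * f x) :=
      ((k.compSubConstCLM ℂ y).memLp (1 - p⁻¹)⁻¹ volume).integrable_mul (Lp.memLp f)
    simpa [H, HasFiniteIntegral, enorm_mul] using h1.2
  have hFH : ∀ y, ‖F y‖ₑ ≤ H y := fun y => by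
    refine (enorm_integral_le_lintegral_enorm _).trans_eq ?_
    simp [H, enorm_mul]
  have hjoint : StronglyMeasurable fun z : E × E => k (z.2 - z.1) * f z.2 :=
    (k.continuous.comp (continuous_snd.sub continuous_fst)).stronglyMeasurable.mul
      ((Lp.stronglyMeasurable f).comp_measurable measurable_snd)
  have hFm : StronglyMeasurable F := hjoint.integral_prod_right'
  have hkfin : (∫⁻ x, ‖k x‖ₑ) < ∞ := (k.integrable (μ := volume)).2
  have hHlt : eLpNorm H p volume < ∞ :=
    hyoung.trans_lt (ENNReal.mul_lt_top hkfin (Lp.memLp f).2)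
  have hFle : eLpNorm F p volume ≤ eLpNorm H p volume := eLpNorm_mono_enorm hFH
  have hFmem : MemLp F p volume := ⟨hFm.aestronglyMeasurable, hFle.trans_lt hHlt⟩
  have hHr : MemLp (fun y => (H y).toReal) p volume := by
    refine ⟨hHm.ennreal_toReal.aestronglyMeasurable, lt_of_le_of_lt ?_ hHlt⟩
    refine eLpNorm_mono_enorm fun y => ?_
    rw [Real.enorm_eq_ofReal ENNReal.toReal_nonneg, ENNReal.ofReal_toReal (hHtop y).ne,
      enorm_eq_self]
  -- By Fubini the correlation `F` defines the same distribution as `g`. Since `L^p` embeds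
  -- injectively in the tempered distributions, `F = g` and the Young bound for `F` passes to `g`.
  have hdist : Lp.toTemperedDistribution (hFmem.toLp F) = Lp.toTemperedDistribution g := by
    ext φ
    rw [h, Lp.toTemperedDistribution_apply]
    have hint : Integrable (fun z : E × E => φ z.1 * (k (z.2 - z.1) * f z.2))
        ((volume : Measure E).prod volume) :=
      integrable_mul_prod (G := H) φ.continuous.stronglyMeasurable hjoint
        (fun y => by simp [H, enorm_mul]) hHtop
        ((φ.memLp (1 - p⁻¹)⁻¹ volume).integrable_mul hHr.ofReal)
    calc ∫ y, φ y • (hFmem.toLp F) y = ∫ y, ∫ x, φ y * (k (x - y) * f x) := by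
          refine integral_congr_ae ?_
          filter_upwards [hFmem.coeFn_toLp] with y hy
          rw [hy, smul_eq_mul, integral_const_mul]
      _ = ∫ x, ∫ y, φ y * (k (x - y) * f x) := integral_integral_swap hint
      _ = _ := by
          refine integral_congr_ae (Eventually.of_forall fun x => ?_)
          simp only
          rw [← integral_mul_const]
          exact integral_congr_ae (Eventually.of_forall fun y => by simp only; ring)
  have hinj : hFmem.toLp F = g := by
    have := LinearMap.ker_eq_bot.1
      (Lp.ker_toTemperedDistributionCLM_eq_bot (F := ℂ) (μ := (volume : Measure E)) (p := p))
    exact this hdist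
  rw [← hinj, eLpNorm_congr_ae hFmem.coeFn_toLp]
  exact hFle.trans hyoung

end Convolution

/-! ### Tempered distributions vanish off their support. -/

section Localization

open Distribution
open scoped Manifold ContDiff

variable {E : Type*} [NormedAddCommGroup E] [InnerProductSpace ℝ E]

theorem isVanishingOn_empty (T : 𝓢'(E, ℂ)) : IsVanishingOn T (∅ : Set E) := by
  intro u hu
  have h0 : u = 0 := by
    ext x
    exact image_eq_zero_of_notMem_tsupport fun hx => hu hx
  rw [h0, map_zero]

/-- Finitely many open sets on which `T` vanishes cover the support of `v`; a subordinate smooth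
partition of unity splits `v` into pieces killed by `T`. -/
theorem map_eq_zero_of_hasCompactSupport [FiniteDimensional ℝ E] {T : 𝓢'(E, ℂ)}
    {v : 𝓢(E, ℂ)} (hv : HasCompactSupport v) (hd : Disjoint (tsupport v) (dsupport T)) : T v = 0 := by
  -- The empty set serves as a default off the support, so that `U` is defined on all of `E`.
  have hU : ∀ x : E, ∃ s : Set E, IsOpen s ∧ IsVanishingOn T s ∧ (x ∈ tsupport v → x ∈ s) := by
    intro x
    by_cases hx : x ∈ tsupport v
    · obtain ⟨s, hs, ho, hxs⟩ := (notMem_dsupport_iff (f := T) x).1 (Set.disjoint_left.1 hd hx)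
      exact ⟨s, ho, hs, fun _ => hxs⟩
    · exact ⟨∅, isOpen_empty, isVanishingOn_empty T, fun h => absurd h hx⟩
  choose U hUo hUv hUx using hU
  obtain ⟨t, ht⟩ := hv.isCompact.elim_nhds_subcover' (fun x _ => U x)
    (fun x hx => (hUo x).mem_nhds (hUx x hx))
  obtain ⟨ρ, hρ⟩ := SmoothPartitionOfUnity.exists_isSubordinate 𝓘(ℝ, E) (isClosed_tsupport v)
    (fun i : t => U i) (fun i => hUo i) (by
      intro x hx
      obtain ⟨i, hi, hxi⟩ := Set.mem_iUnion₂.1 (ht hx)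
      exact Set.mem_iUnion.2 ⟨⟨i, hi⟩, hxi⟩)
  have hsm : ∀ i, ContDiff ℝ ∞ fun x => (ρ i x : ℂ) * v x := fun i =>
    (Complex.ofRealCLM.contDiff.comp (ρ i).contMDiff.contDiff).mul (v.smooth _)
  have hcs : ∀ i, HasCompactSupport fun x => (ρ i x : ℂ) * v x := fun i => hv.mul_left
  set w : t → 𝓢(E, ℂ) := fun i => (hcs i).toSchwartzMap (hsm i)
  have hsum : v = ∑ i, w i := by
    ext x
    have h1 : (∑ i, w i) x = ∑ i, w i x := by
      simp
    rw [h1]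
    change v x = ∑ i, (ρ i x : ℂ) * v x
    rw [← Finset.sum_mul]
    by_cases hx : x ∈ tsupport v
    · have := ρ.sum_eq_one hx
      rw [finsum_eq_sum_of_fintype] at this
      rw [← Complex.ofReal_sum, this]
      simp
    · rw [image_eq_zero_of_notMem_tsupport hx, mul_zero]
  rw [hsum, map_sum]
  refine Finset.sum_eq_zero fun i _ => hUv i (w i) ?_
  refine subset_trans ?_ (hρ i)
  refine closure_mono fun x hx => ?_
  rw [Function.mem_support] at hx ⊢
  intro h0
  exact hx (by change (ρ i x : ℂ) * v x = 0; rw [h0]; simp)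

/-- For `j = 0` the function vanishes unless `1 < t‖x‖`, where the bound 1 suffices. For `j ≥ 1` the
chain rule yields `t ^ j ≤ t`. -/
theorem exists_norm_iteratedFDeriv_dilate_le {η : 𝓢(E, ℂ)} (h1 : ∀ x, ‖x‖ ≤ 1 → η x = 1)
    (hle : ∀ x, ‖1 - η x‖ ≤ 1) (j : ℕ) : ∃ C, 0 ≤ C ∧ ∀ t : ℝ, 0 < t → t ≤ 1 → ∀ x,
      ‖iteratedFDeriv ℝ j (fun y => 1 - η (t • y)) x‖ ≤ C * t * (1 + ‖x‖) := by
  rcases Nat.eq_zero_or_pos j with rfl | hj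
  · refine ⟨1, zero_le_one, fun t ht ht1 x => ?_⟩
    rw [norm_iteratedFDeriv_zero]
    by_cases hx : ‖t • x‖ ≤ 1
    · rw [h1 _ hx]; simp; positivity
    · refine (hle _).trans ?_
      rw [norm_smul, Real.norm_of_nonneg ht.le, not_le] at hx
      linarith
  · refine ⟨SchwartzMap.seminorm ℂ 0 j η, by positivity, fun t ht ht1 x => ?_⟩
    have hcd : ContDiff ℝ ∞ fun y => η (t • y) :=
      (η.smooth _).comp (contDiff_const_smul t)
    have e1 : iteratedFDeriv ℝ j (fun y => 1 - η (t • y)) x =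
        - iteratedFDeriv ℝ j (fun y => η (t • y)) x := by
      have := iteratedFDeriv_sub_apply (𝕜 := ℝ) (i := j) (f := fun _ : E => (1 : ℂ))
        (g := fun y => η (t • y)) (x := x) contDiff_const.contDiffAt
        ((hcd.of_le (by exact_mod_cast le_top)).contDiffAt)
      rw [show (fun y => 1 - η (t • y)) = (fun _ : E => (1 : ℂ)) - fun y => η (t • y) from rfl,
        this, iteratedFDeriv_const_of_ne hj.ne']
      simp
    have e2 : iteratedFDeriv ℝ j (fun y => η (t • y)) x =
        t ^ j • iteratedFDeriv ℝ j η (t • x) := by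
      rw [iteratedFDeriv_comp_const_smul t (η.smooth j)]
    rw [e1, norm_neg, e2, norm_smul, Real.norm_of_nonneg (by positivity)]
    have h3 := SchwartzMap.norm_iteratedFDeriv_le_seminorm ℂ η j (t • x)
    calc _ ≤ t * SchwartzMap.seminorm ℂ 0 j η := by
          gcongr
          exact pow_le_of_le_one ht.le ht1 hj.ne'
      _ ≤ (SchwartzMap.seminorm ℂ 0 j η * t) * (1 + ‖x‖) := by
          rw [mul_comm]
          exact le_mul_of_one_le_right (by positivity) (by linarith [norm_nonneg x])

/-- The factor `1 + ‖x‖` in the derivative bound is paid for by one extra power of decay of `v`,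
hence the seminorms of index `k + 1`. -/
theorem exists_seminorm_dilate_le {η : 𝓢(E, ℂ)} (h1 : ∀ x, ‖x‖ ≤ 1 → η x = 1)
    (hle : ∀ x, ‖1 - η x‖ ≤ 1) (v : 𝓢(E, ℂ)) (k l : ℕ) : ∃ C, ∀ t : ℝ, 0 < t → t ≤ 1 →
      ∀ w : 𝓢(E, ℂ), (∀ x, w x = (1 - η (t • x)) * v x) →
        SchwartzMap.seminorm ℂ k l w ≤ C * t := by
  choose C hC0 hC using exists_norm_iteratedFDeriv_dilate_le h1 hle
  set S : ℕ → ℝ := fun j => SchwartzMap.seminorm ℂ k (l - j) v +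
    SchwartzMap.seminorm ℂ (k + 1) (l - j) v
  have hS : ∀ j, 0 ≤ S j := fun j => by positivity
  refine ⟨∑ j ∈ Finset.range (l + 1), (l.choose j : ℝ) * C j * S j, fun t ht ht1 w hw => ?_⟩
  refine SchwartzMap.seminorm_le_bound ℂ k l _ (mul_nonneg (Finset.sum_nonneg fun j _ =>
    mul_nonneg (mul_nonneg (by positivity) (hC0 j)) (hS j)) ht.le) fun x => ?_
  have hwf : (w : E → ℂ) = fun y => (1 - η (t • y)) * v y := funext hw
  have hcd : ContDiff ℝ ∞ fun y => 1 - η (t • y) :=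
    contDiff_const.sub ((η.smooth _).comp (contDiff_const_smul t))
  rw [hwf]
  calc _ ≤ ‖x‖ ^ k * ∑ j ∈ Finset.range (l + 1), (l.choose j : ℝ) *
        ‖iteratedFDeriv ℝ j (fun y => 1 - η (t • y)) x‖ * ‖iteratedFDeriv ℝ (l - j) v x‖ := by
        gcongr
        exact norm_iteratedFDeriv_mul_le (N := ∞) hcd (v.smooth _) x
          (by exact_mod_cast le_top)
    _ ≤ ‖x‖ ^ k * ∑ j ∈ Finset.range (l + 1), (l.choose j : ℝ) *
        (C j * t * (1 + ‖x‖)) * ‖iteratedFDeriv ℝ (l - j) v x‖ := by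
        gcongr with j
        exact hC j t ht ht1 x
    _ = ∑ j ∈ Finset.range (l + 1), (l.choose j : ℝ) * C j *
        (‖x‖ ^ k * ‖iteratedFDeriv ℝ (l - j) v x‖ +
          ‖x‖ ^ (k + 1) * ‖iteratedFDeriv ℝ (l - j) v x‖) * t := by
        rw [Finset.mul_sum]
        exact Finset.sum_congr rfl fun j _ => by ring
    _ ≤ ∑ j ∈ Finset.range (l + 1), (l.choose j : ℝ) * C j * S j * t := by
        gcongr with j
        · exact mul_nonneg (by positivity) (hC0 j)
        · exact add_le_add (SchwartzMap.le_seminorm ℂ k (l - j) v x)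
            (SchwartzMap.le_seminorm ℂ (k + 1) (l - j) v x)
    _ = _ := by rw [Finset.sum_mul]

/-- A tempered distribution annihilates the Schwartz functions supported off its support. -/
theorem map_eq_zero_of_disjoint_dsupport [FiniteDimensional ℝ E] {T : 𝓢'(E, ℂ)} {v : 𝓢(E, ℂ)}
    (hd : Disjoint (tsupport v) (dsupport T)) : T v = 0 := by
  let b : ContDiffBump (0 : E) := ⟨1, 2, one_pos, one_lt_two⟩
  have hcs : HasCompactSupport fun x => (b x : ℂ) :=
    b.hasCompactSupport.comp_left (g := Complex.ofReal) rfl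
  have hsm : ContDiff ℝ ∞ fun x => (b x : ℂ) := Complex.ofRealCLM.contDiff.comp b.contDiff
  set η : 𝓢(E, ℂ) := hcs.toSchwartzMap hsm
  have hη : ∀ x, η x = b x := fun _ => rfl
  have h1 : ∀ x, ‖x‖ ≤ 1 → η x = 1 := fun x hx => by
    rw [hη, b.one_of_mem_closedBall (by simpa using hx)]; simp
  have hle : ∀ x, ‖1 - η x‖ ≤ 1 := fun x => by
    rw [hη, ← Complex.ofReal_one, ← Complex.ofReal_sub, Complex.norm_real,
      Real.norm_of_nonneg (by linarith [b.le_one (x := x)])]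
    linarith [b.nonneg (x := x)]
  set t : ℕ → ℝ := fun n => 1 / ((n : ℝ) + 1)
  have ht0 : ∀ n, 0 < t n := fun n => Nat.one_div_pos_of_nat
  have ht1 : ∀ n, t n ≤ 1 := fun n => by
    rw [div_le_one (by positivity)]; linarith [(Nat.cast_nonneg n : (0 : ℝ) ≤ n)]
  have hηcs : ∀ n, HasCompactSupport fun x => η (t n • x) := fun n =>
    hcs.comp_homeomorph (Homeomorph.smulOfNeZero (t n) (ht0 n).ne')
  have hvsm : ∀ n, ContDiff ℝ ∞ fun x => η (t n • x) * v x := fun n =>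
    ((η.smooth _).comp (contDiff_const_smul (t n))).mul (v.smooth _)
  have hvcs : ∀ n, HasCompactSupport fun x => η (t n • x) * v x := fun n => (hηcs n).mul_right
  set w : ℕ → 𝓢(E, ℂ) := fun n => (hvcs n).toSchwartzMap (hvsm n)
  have hw : ∀ n x, w n x = η (t n • x) * v x := fun _ _ => rfl
  have hTw : ∀ n, T (w n) = 0 := fun n => map_eq_zero_of_hasCompactSupport (hvcs n)
    (hd.mono_left (closure_mono (Function.support_mul_subset_right _ _)))
  -- The truncations `η(t x) v(x)` have compact support and converge to `v` in the Schwartz topology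
  -- as `t → 0`, so continuity of `T` reduces the claim to the compact case.
  have hlim : Tendsto w atTop (𝓝 v) := by
    rw [(schwartz_withSeminorms ℂ E ℂ).tendsto_nhds]
    rintro ⟨k, l⟩ ε hε
    obtain ⟨C, hC⟩ := exists_seminorm_dilate_le h1 hle v k l
    have hCt : Tendsto (fun n => C * t n) atTop (𝓝 0) := by
      simpa [t] using (tendsto_one_div_add_atTop_nhds_zero_nat (𝕜 := ℝ)).const_mul C
    filter_upwards [hCt.eventually_lt_const hε] with n hn
    rw [← neg_sub, map_neg_eq_map]
    refine lt_of_le_of_lt (hC (t n) (ht0 n) (ht1 n) (v - w n) fun x => ?_) hn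
    rw [sub_apply, hw]; ring
  have h2 : Tendsto (fun n => T (w n)) atTop (𝓝 (T v)) := ((map_continuous T).tendsto v).comp hlim
  simp only [hTw] at h2
  exact (tendsto_nhds_unique h2 tendsto_const_nhds)

end Localization

/-! ### Fourier multipliers and the convolution kernel. -/

section Fourier

variable {d : ℕ}

/-- The inverse of `fourierSchwartz`. -/
noncomputable def fourierSchwartzInv (d : ℕ) : 𝓢(Space d, ℂ) →L[ℂ] 𝓢(Space d, ℂ) :=
  (((2 * Real.pi) ^ (-(d : ℝ) / 2) : ℝ) : ℂ)⁻¹ •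
    (FourierTransform.fourierInvCLM ℂ 𝓢(Space d, ℂ)).comp
      (SchwartzMap.compCLMOfContinuousLinearEquiv ℂ (dilation d).symm)

theorem fourierConst_ne_zero (d : ℕ) : (((2 * Real.pi) ^ (-(d : ℝ) / 2) : ℝ) : ℂ) ≠ 0 := by
  have : 0 < 2 * Real.pi := by positivity
  exact_mod_cast (Real.rpow_pos_of_pos this _).ne'

theorem fourierSchwartz_eq (φ : 𝓢(Space d, ℂ)) :
    fourierSchwartz d φ = (((2 * Real.pi) ^ (-(d : ℝ) / 2) : ℝ) : ℂ) •
      SchwartzMap.compCLMOfContinuousLinearEquiv ℂ (dilation d) (𝓕 φ) := rfl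

theorem fourierSchwartzInv_eq (φ : 𝓢(Space d, ℂ)) :
    fourierSchwartzInv d φ = (((2 * Real.pi) ^ (-(d : ℝ) / 2) : ℝ) : ℂ)⁻¹ •
      𝓕⁻ (SchwartzMap.compCLMOfContinuousLinearEquiv ℂ (dilation d).symm φ) := rfl

theorem fourierSchwartz_fourierSchwartzInv (φ : 𝓢(Space d, ℂ)) :
    fourierSchwartz d (fourierSchwartzInv d φ) = φ := by
  rw [fourierSchwartzInv_eq, map_smul, fourierSchwartz_eq, smul_smul,
    inv_mul_cancel₀ (fourierConst_ne_zero d), one_smul, FourierTransform.fourier_fourierInv_eq]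
  ext x
  simp

theorem dilation_apply (x : Space d) : dilation d x = (2 * Real.pi)⁻¹ • x := rfl

theorem dilation_symm_apply (x : Space d) : (dilation d).symm x = (2 * Real.pi) • x := by
  rw [ContinuousLinearEquiv.symm_apply_eq, dilation_apply, smul_smul,
    inv_mul_cancel₀ (by positivity), one_smul]

/-! ### Fourier multipliers -/

/-- The operator `A` acts on the Fourier side as multiplication by `a`. -/
structure HasFourierMultiplier (A : 𝓢'(Space d, ℂ) →L[ℂ] 𝓢'(Space d, ℂ)) (a : Space d → ℂ) :
    Prop where
  hasTemperateGrowth : a.HasTemperateGrowth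
  fourierDist_eq : ∀ T, fourierDist (A T) = TemperedDistribution.smulLeftCLM ℂ a (fourierDist T)

namespace HasFourierMultiplier

variable {A B : 𝓢'(Space d, ℂ) →L[ℂ] 𝓢'(Space d, ℂ)} {a b : Space d → ℂ}

theorem one : HasFourierMultiplier (d := d) 1 1 :=
  ⟨by exact Function.HasTemperateGrowth.const 1, fun T => by
    rw [show (1 : Space d → ℂ) = fun _ => 1 from rfl, TemperedDistribution.smulLeftCLM_const]
    simp⟩

theorem mul (hA : HasFourierMultiplier A a) (hB : HasFourierMultiplier B b) :
    HasFourierMultiplier (A * B) (a * b) := by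
  refine ⟨hA.1.mul hB.1, fun T => ?_⟩
  rw [mul_apply_eq_comp, hA.2, hB.2,
    TemperedDistribution.smulLeftCLM_smulLeftCLM_apply hB.1 hA.1, mul_comm]

theorem pow (hA : HasFourierMultiplier A a) (n : ℕ) : HasFourierMultiplier (A ^ n) (a ^ n) := by
  induction n with
  | zero => simpa using one
  | succ n ih => rw [pow_succ, pow_succ]; exact ih.mul hA

theorem list_prod {ι : Type*} (l : List ι) {A : ι → 𝓢'(Space d, ℂ) →L[ℂ] 𝓢'(Space d, ℂ)}
    {a : ι → Space d → ℂ} (h : ∀ i, HasFourierMultiplier (A i) (a i)) :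
    HasFourierMultiplier (l.map A).prod (l.map a).prod := by
  induction l with
  | nil => exact one
  | cons i l ih => simpa using (h i).mul ih

theorem const_smul (hA : HasFourierMultiplier A a) (c : ℂ) :
    HasFourierMultiplier (c • A) (c • a) := by
  refine ⟨(Function.HasTemperateGrowth.const c).mul hA.1, fun T => ?_⟩
  rw [TemperedDistribution.smulLeftCLM_smul hA.1, smul_apply, smul_apply, ← hA.2]
  exact map_smul (PointwiseConvergenceCLM.precomp ℂ (fourierSchwartz d)) c (A T)

theorem sum {ι : Type*} (s : Finset ι) {A : ι → 𝓢'(Space d, ℂ) →L[ℂ] 𝓢'(Space d, ℂ)}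
    {a : ι → Space d → ℂ} (h : ∀ i, HasFourierMultiplier (A i) (a i)) :
    HasFourierMultiplier (∑ i ∈ s, A i) (fun x => ∑ i ∈ s, a i x) := by
  refine ⟨Function.HasTemperateGrowth.sum fun i _ => (h i).1, fun T => ?_⟩
  rw [TemperedDistribution.smulLeftCLM_sum fun i _ => (h i).1, sum_apply, sum_apply]
  simp_rw [← fun i => (h i).2]
  exact map_sum (PointwiseConvergenceCLM.precomp ℂ (fourierSchwartz d)) _ _

theorem lineDerivOp (m : Space d) :
    HasFourierMultiplier (LineDeriv.lineDerivOpCLM ℂ 𝓢'(Space d, ℂ) m)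
      (fun ξ => Complex.I * ((inner ℝ ξ m : ℝ) : ℂ)) := by
  have hg : (fun ξ : Space d => Complex.I * ((inner ℝ ξ m : ℝ) : ℂ)).HasTemperateGrowth := by
    fun_prop
  have hi : (fun ξ : Space d => (inner ℝ ξ (dilation d m) : ℝ)).HasTemperateGrowth := by fun_prop
  refine ⟨hg, fun T => ?_⟩
  ext φ
  rw [TemperedDistribution.smulLeftCLM_apply_apply, fourierDist_apply, fourierDist_apply]
  change T (-∂_{m} (fourierSchwartz d φ)) = _
  congr 1
  have hπ : (Real.pi : ℂ) ≠ 0 := by exact_mod_cast Real.pi_ne_zero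
  -- Differentiating `𝓕` produces `2πi`, and the chain rule through the dilation `(2π)⁻¹`; together
  -- they leave `i⟨ξ, m⟩`.
  have key : (2 * Real.pi * Complex.I) •
      SchwartzMap.smulLeftCLM ℂ (fun ξ => (inner ℝ ξ (dilation d m) : ℝ)) φ =
      SchwartzMap.smulLeftCLM ℂ (fun ξ => Complex.I * ((inner ℝ ξ m : ℝ) : ℂ)) φ := by
    ext x
    rw [SchwartzMap.smulLeftCLM_apply_apply hg, smul_apply,
      SchwartzMap.smulLeftCLM_apply_apply hi, dilation_apply, inner_smul_right]
    simp only [smul_eq_mul, Complex.real_smul]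
    push_cast
    field_simp
  rw [← key, fourierSchwartz_eq, fourierSchwartz_eq, LineDeriv.lineDerivOp_smul,
    SchwartzMap.lineDerivOp_compCLMOfContinuousLinearEquiv, SchwartzMap.lineDerivOp_fourier_eq,
    neg_smul, FourierTransform.fourier_neg, map_neg, smul_neg, neg_neg]

end HasFourierMultiplier

theorem hasFourierMultiplier_monomialDeriv (m : Fin d →₀ ℕ) :
    HasFourierMultiplier (monomialDeriv m) (fun ξ => ∏ j, (Complex.I * (ξ j : ℂ)) ^ m j) := by
  have h := HasFourierMultiplier.list_prod (List.finRange d) fun j : Fin d =>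
    (HasFourierMultiplier.lineDerivOp (EuclideanSpace.single j (1 : ℝ))).pow (m j)
  have ha : (fun ξ : Space d => ∏ j, (Complex.I * (ξ j : ℂ)) ^ m j) =
      ((List.finRange d).map fun j : Fin d =>
        (fun ξ : Space d => Complex.I *
          ((inner ℝ ξ (EuclideanSpace.single j (1 : ℝ)) : ℝ) : ℂ)) ^ m j).prod := by
    rw [← Fin.prod_univ_def]
    ext ξ
    simp [EuclideanSpace.inner_single_right]
  rw [ha]
  exact h

theorem hasFourierMultiplier_diffOp (P : MvPolynomial (Fin d) ℂ) :
    HasFourierMultiplier (diffOp P) (symbol P) := by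
  have h := HasFourierMultiplier.sum P.support fun m =>
    (hasFourierMultiplier_monomialDeriv m).const_smul (P.coeff m)
  have ha : symbol P = fun ξ : Space d => ∑ m ∈ P.support,
      (P.coeff m • fun ξ : Space d => ∏ j, (Complex.I * (ξ j : ℂ)) ^ m j) ξ := by
    ext ξ
    simp [symbol, MvPolynomial.eval_eq']
  rw [ha]
  exact h

theorem diffOp_pow_apply_fourierSchwartz (P : MvPolynomial (Fin d) ℂ) (n : ℕ)
    (T : 𝓢'(Space d, ℂ)) (φ : 𝓢(Space d, ℂ)) :
    ((diffOp P) ^ n) T (fourierSchwartz d φ) =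
      fourierDist T (SchwartzMap.smulLeftCLM ℂ (symbol P ^ n) φ) := by
  rw [← fourierDist_apply, ((hasFourierMultiplier_diffOp P).pow n).2,
    TemperedDistribution.smulLeftCLM_apply_apply]

theorem contDiff_symbol (P : MvPolynomial (Fin d) ℂ) : ContDiff ℝ (⊤ : ℕ∞) (symbol P) :=
  (hasFourierMultiplier_diffOp P).1.1

/-! ### Multiplication and convolution -/

/-- The kernel `k` such that `𝓕 (χ · 𝓕⁻¹ φ) = k * φ`. -/
noncomputable def kernelCLM (d : ℕ) : 𝓢(Space d, ℂ) →L[ℂ] 𝓢(Space d, ℂ) :=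
  (((|((2 * Real.pi) ^ d)⁻¹| : ℝ) : ℂ)) •
    (SchwartzMap.compCLMOfContinuousLinearEquiv ℂ (dilation d)).comp
      (FourierTransform.fourierCLM ℂ 𝓢(Space d, ℂ))

theorem kernelCLM_apply (χ : 𝓢(Space d, ℂ)) (x : Space d) :
    kernelCLM d χ x = ((|((2 * Real.pi) ^ d)⁻¹| : ℝ) : ℂ) * 𝓕 χ ((2 * Real.pi)⁻¹ • x) := rfl

theorem fourierInv_apply_neg (χ : 𝓢(Space d, ℂ)) (x : Space d) : (𝓕⁻ χ) (-x) = 𝓕 χ x := by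
  rw [SchwartzMap.fourierInv_apply_eq]
  simp

/-- The convolution theorem for `𝓕⁻`, evaluated at `-x` to turn `𝓕⁻` into `𝓕`. -/
theorem fourier_pairing_apply (χ v : 𝓢(Space d, ℂ)) (x : Space d) :
    𝓕 (SchwartzMap.pairing (ContinuousLinearMap.mul ℂ ℂ) χ v) x =
      ∫ y, 𝓕 χ (x - y) * 𝓕 v y := by
  have h := SchwartzMap.convolution_apply (ContinuousLinearMap.mul ℂ ℂ) (𝓕⁻ χ) (𝓕⁻ v) (-x)
  have h2 : SchwartzMap.convolution (ContinuousLinearMap.mul ℂ ℂ) (𝓕⁻ χ) (𝓕⁻ v) =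
      𝓕⁻ (SchwartzMap.pairing (ContinuousLinearMap.mul ℂ ℂ) χ v) := by
    change 𝓕⁻ (SchwartzMap.pairing (ContinuousLinearMap.mul ℂ ℂ) (𝓕 (𝓕⁻ χ)) (𝓕 (𝓕⁻ v))) = _
    rw [FourierTransform.fourier_fourierInv_eq, FourierTransform.fourier_fourierInv_eq]
  rw [h2, fourierInv_apply_neg, convolution_def] at h
  rw [h, ← integral_sub_right_eq_self _ x]
  refine integral_congr_ae (Eventually.of_forall fun y => ?_)
  simp only [ContinuousLinearMap.mul_apply']
  rw [← fourierInv_apply_neg χ, ← fourierInv_apply_neg v]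
  congr 2 <;> abel_nf

theorem fourierSchwartz_pairing_fourierSchwartzInv (χ φ : 𝓢(Space d, ℂ)) (x : Space d) :
    fourierSchwartz d
      (SchwartzMap.pairing (ContinuousLinearMap.mul ℂ ℂ) χ (fourierSchwartzInv d φ)) x =
      ∫ y, kernelCLM d χ (x - y) * φ y := by
  have hv : ∀ y, 𝓕 (fourierSchwartzInv d φ) y =
      (((2 * Real.pi) ^ (-(d : ℝ) / 2) : ℝ) : ℂ)⁻¹ * φ ((2 * Real.pi) • y) := fun y => by
    rw [fourierSchwartzInv_eq, FourierTransform.fourier_smul,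
      FourierTransform.fourier_fourierInv_eq, smul_apply, smul_eq_mul,
      SchwartzMap.compCLMOfContinuousLinearEquiv_apply, Function.comp_apply, dilation_symm_apply]
  rw [fourierSchwartz_eq, smul_apply, SchwartzMap.compCLMOfContinuousLinearEquiv_apply,
    Function.comp_apply, dilation_apply, fourier_pairing_apply]
  simp_rw [hv, kernelCLM_apply, mul_assoc]
  have hπ : (2 * Real.pi : ℝ) ≠ 0 := by positivity
  -- The two normalizing constants cancel, so the constant in `kernelCLM` is exactly the Jacobian of
  -- `y ↦ 2πy`.
  have h := Measure.integral_comp_smul (volume : Measure (Space d))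
    (fun y => 𝓕 χ ((2 * Real.pi)⁻¹ • (x - y)) * φ y) (2 * Real.pi)
  simp only [finrank_euclideanSpace_fin, Complex.real_smul, smul_sub, smul_smul,
    inv_mul_cancel₀ hπ, one_smul] at h
  rw [integral_const_mul]
  simp_rw [smul_sub]
  rw [← h, smul_eq_mul, ← integral_const_mul]
  refine integral_congr_ae (Eventually.of_forall fun y => ?_)
  simp only
  rw [mul_left_comm, mul_left_comm _ _ (φ _), inv_mul_cancel_left₀ (fourierConst_ne_zero d)]

end Fourier

open Distribution
open scoped Manifold ContDiff

/-! ### The two exponential estimates. -/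

section Estimates

theorem exists_contDiff_cutoff {E : Type*} [NormedAddCommGroup E] [InnerProductSpace ℝ E]
    [FiniteDimensional ℝ E] {K U : Set E} (hK : IsCompact K) (hU : IsOpen U) (hKU : K ⊆ U) :
    ∃ θ : E → ℂ, ContDiff ℝ ∞ θ ∧ HasCompactSupport θ ∧ tsupport θ ⊆ U ∧
      ∀ᶠ x in 𝓝ˢ K, θ x = 1 := by
  obtain ⟨L, hL, hKL, hLU⟩ := exists_compact_between hK hU hKU
  obtain ⟨θ, h1, h0, -⟩ := exists_contMDiffMap_one_nhds_of_subset_interior (n := (⊤ : ℕ∞)) 𝓘(ℝ, E)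
    hK.isClosed hKL
  have hsub : tsupport (fun x => (θ x : ℂ)) ⊆ L := by
    refine closure_minimal (fun x hx => ?_) hL.isClosed
    by_contra hxL
    exact hx (by simp [h0 x hxL])
  exact ⟨fun x => (θ x : ℂ), Complex.ofRealCLM.contDiff.comp θ.contMDiff.contDiff,
    hL.of_isClosed_subset (isClosed_tsupport _) hsub, hsub.trans hLU,
    h1.mono fun x hx => by simp [hx]⟩

theorem contDiff_mul_inv_of_tsupport_subset {E : Type*} [NormedAddCommGroup E] [NormedSpace ℝ E]
    {θ a : E → ℂ} (hθ : ContDiff ℝ ∞ θ) (ha : ContDiff ℝ ∞ a)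
    (h : ∀ x ∈ tsupport θ, a x ≠ 0) : ContDiff ℝ ∞ fun x => θ x * (a x)⁻¹ := by
  refine contDiff_iff_contDiffAt.2 fun x => ?_
  by_cases hx : x ∈ tsupport θ
  · exact hθ.contDiffAt.mul (ha.contDiffAt.inv (h x hx))
  · refine (contDiffAt_const (c := (0 : ℂ))).congr_of_eventuallyEq ?_
    filter_upwards [(isClosed_tsupport θ).isOpen_compl.mem_nhds hx] with y hy
    rw [image_eq_zero_of_notMem_tsupport hy, zero_mul]

theorem exists_norm_toTemperedDistribution_le {E : Type*} [NormedAddCommGroup E]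
    [NormedSpace ℝ E] [MeasurableSpace E] [BorelSpace E] {μ : Measure E}
    [μ.HasTemperateGrowth] (p : ℝ≥0∞) [hp : Fact (1 ≤ p)] :
    ∃ (q : ℝ≥0∞) (_ : Fact (1 ≤ q)) (C : ℝ), 0 ≤ C ∧ ∀ (g : Lp ℂ p μ) (φ : 𝓢(E, ℂ)),
      ‖Lp.toTemperedDistribution g φ‖ ≤ C * ‖g‖ * ‖SchwartzMap.toLpCLM ℂ ℂ q μ φ‖ := by
  have := ENNReal.HolderConjugate.inv_one_sub_inv' hp.out
  have hq : Fact (1 ≤ (1 - p⁻¹)⁻¹) := by simp [fact_iff]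
  set B := (ContinuousLinearMap.lsmul ℂ ℂ (E := ℂ)).flip.lpPairing μ p (1 - p⁻¹)⁻¹
  refine ⟨(1 - p⁻¹)⁻¹, hq, ‖B‖, B.opNorm_nonneg, fun g φ => ?_⟩
  have hB : Lp.toTemperedDistribution g φ = B g (SchwartzMap.toLpCLM ℂ ℂ (1 - p⁻¹)⁻¹ μ φ) := rfl
  rw [hB]
  exact B.le_opNorm₂ g _

variable {d : ℕ} {P : MvPolynomial (Fin d) ℂ} {p : ℝ≥0∞} [Fact (1 ≤ p)]
  {f : 𝓢'(Space d, ℂ)} {g : ℕ → Lp ℂ p (volume : Measure (Space d))}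

theorem exists_norm_fourierDist_le
    (hg : ∀ n : ℕ, Lp.toTemperedDistribution (g n) = ((diffOp P) ^ n) f)
    {φ : 𝓢(Space d, ℂ)} (hφ : HasCompactSupport φ) {ρ r : ℝ} (hρ : 0 < ρ)
    (hρφ : ∀ ξ ∈ tsupport φ, ρ < ‖symbol P ξ‖) (hr : ρ⁻¹ < r) :
    ∃ C, 0 ≤ C ∧ ∀ n, ‖fourierDist f φ‖ ≤ C * r ^ n * ‖g n‖ := by
  have hcd := contDiff_symbol P
  have htg := (hasFourierMultiplier_diffOp P).1
  obtain ⟨θ, hθ, hθc, hθU, hθ1⟩ := exists_contDiff_cutoff hφ.isCompact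
    (isOpen_ne_fun hcd.continuous continuous_const) (U := {ξ | symbol P ξ ≠ 0})
    fun ξ hξ => norm_pos_iff.1 (hρ.trans (hρφ ξ hξ))
  have hθ1' : ∀ ξ ∈ tsupport φ, θ ξ = 1 := fun ξ hξ => hθ1.self_of_nhdsSet ξ hξ
  -- The symbol may have zeros elsewhere; the cutoff makes its inverse globally smooth without
  -- changing it on the support of `φ`.
  set u : Space d → ℂ := fun ξ => θ ξ * (symbol P ξ)⁻¹
  have hu : ContDiff ℝ ∞ u := contDiff_mul_inv_of_tsupport_subset hθ hcd hθU
  have hut : u.HasTemperateGrowth :=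
    (hθc.mul_right : HasCompactSupport u).hasTemperateGrowth hu
  have huM : ∀ ξ ∈ tsupport φ, ‖u ξ‖ ≤ ρ⁻¹ := fun ξ hξ => by
    simp only [u, hθ1' ξ hξ, one_mul, norm_inv]
    exact inv_anti₀ hρ (hρφ ξ hξ).le
  have hw : ∀ n x, SchwartzMap.smulLeftCLM ℂ (u ^ n) φ x = u x ^ n * φ x := fun n x => by
    rw [SchwartzMap.smulLeftCLM_apply_apply (hut.pow n)]; rfl
  obtain ⟨q, _, D, hD0, hD⟩ :=
    exists_norm_toTemperedDistribution_le (μ := (volume : Measure (Space d))) p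
  obtain ⟨C, hC0, hC⟩ := exists_norm_clm_pow_mul_le
    ((SchwartzMap.toLpCLM ℂ ℂ q (volume : Measure (Space d))).comp (fourierSchwartz d)) hu hφ
    (inv_nonneg.2 hρ.le) huM (sub_pos.2 hr) hw
  refine ⟨D * C, mul_nonneg hD0 hC0, fun n => ?_⟩
  have hφn : SchwartzMap.smulLeftCLM ℂ (symbol P ^ n) (SchwartzMap.smulLeftCLM ℂ (u ^ n) φ) = φ := by
    ext ξ
    rw [SchwartzMap.smulLeftCLM_apply_apply (htg.pow n), hw, smul_eq_mul, Pi.pow_apply,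
      ← mul_assoc, ← mul_pow]
    by_cases hξ : ξ ∈ tsupport φ
    · simp only [u, hθ1' ξ hξ, one_mul]
      rw [mul_inv_cancel₀ (norm_pos_iff.1 (hρ.trans (hρφ ξ hξ))), one_pow, one_mul]
    · rw [image_eq_zero_of_notMem_tsupport hξ, mul_zero]
  calc ‖fourierDist f φ‖ = ‖Lp.toTemperedDistribution (g n)
          (fourierSchwartz d (SchwartzMap.smulLeftCLM ℂ (u ^ n) φ))‖ := by
        rw [hg, diffOp_pow_apply_fourierSchwartz, hφn]
    _ ≤ _ := hD _ _
    _ ≤ D * ‖g n‖ * (C * (ρ⁻¹ + (r - ρ⁻¹)) ^ n) := by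
        gcongr
        exact hC n
    _ = _ := by rw [add_sub_cancel]; ring

theorem exists_norm_le_of_norm_symbol_lt
    (hg : ∀ n : ℕ, Lp.toTemperedDistribution (g n) = ((diffOp P) ^ n) f)
    (hK : IsCompact (dsupport (fourierDist f))) {M r : ℝ} (hM : 0 ≤ M)
    (hKM : ∀ ξ ∈ dsupport (fourierDist f), ‖symbol P ξ‖ < M) (hr : M < r) :
    ∃ C, 0 ≤ C ∧ ∀ n, ‖g n‖ ≤ C * r ^ n := by
  have hcd := contDiff_symbol P
  have htg := (hasFourierMultiplier_diffOp P).1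
  obtain ⟨θ, hθ, hθc, hθU, hθ1⟩ := exists_contDiff_cutoff hK
    (isOpen_lt hcd.continuous.norm continuous_const) hKM
  set χ : 𝓢(Space d, ℂ) := hθc.toSchwartzMap hθ
  have hχ : ∀ ξ, χ ξ = θ ξ := fun _ => rfl
  set w : ℕ → 𝓢(Space d, ℂ) := fun n => SchwartzMap.smulLeftCLM ℂ (symbol P ^ n) χ
  have hw : ∀ n x, w n x = symbol P x ^ n * χ x := fun n x => by
    simp only [w]
    rw [SchwartzMap.smulLeftCLM_apply_apply (htg.pow n)]; rfl
  obtain ⟨C, hC0, hC⟩ := exists_norm_clm_pow_mul_le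
    ((SchwartzMap.toLpCLM ℂ ℂ 1 (volume : Measure (Space d))).comp (kernelCLM d)) hcd
    (χ := χ) hθc hM (fun ξ hξ => (hθU hξ).le) (sub_pos.2 hr) hw
  refine ⟨C * ‖g 0‖, by positivity, fun n => ?_⟩
  have hrep : ∀ φ : 𝓢(Space d, ℂ), Lp.toTemperedDistribution (g n) φ =
      ∫ x, (∫ y, kernelCLM d (w n) (x - y) * φ y) * g 0 x := fun φ => by
    set v := fourierSchwartzInv d φ
    have hdiff : fourierDist f (SchwartzMap.smulLeftCLM ℂ (symbol P ^ n) v) =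
        fourierDist f (SchwartzMap.pairing (ContinuousLinearMap.mul ℂ ℂ) (w n) v) := by
      rw [← sub_eq_zero, ← map_sub]
      -- The difference is `P ^ n (1 - θ) v`, which vanishes near the support of `𝓕 f`. Its support
      -- need not be compact, so the general localization result is required.
      refine map_eq_zero_of_disjoint_dsupport (Set.disjoint_left.2 fun ξ hξ hξK => ?_)
      refine (notMem_tsupport_iff_eventuallyEq.2 ?_) hξ
      filter_upwards [hθ1.filter_mono (nhds_le_nhdsSet hξK)] with η hη
      rw [sub_apply, SchwartzMap.smulLeftCLM_apply_apply (htg.pow n),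
        SchwartzMap.pairing_apply_apply, ContinuousLinearMap.mul_apply', hw, hχ, hη]
      simp
    calc Lp.toTemperedDistribution (g n) φ
        = ((diffOp P) ^ n) f (fourierSchwartz d v) := by
          rw [hg, fourierSchwartz_fourierSchwartzInv]
      _ = f (fourierSchwartz d (SchwartzMap.pairing (ContinuousLinearMap.mul ℂ ℂ) (w n) v)) := by
          rw [diffOp_pow_apply_fourierSchwartz, hdiff, fourierDist_apply]
      _ = Lp.toTemperedDistribution (g 0)
            (fourierSchwartz d (SchwartzMap.pairing (ContinuousLinearMap.mul ℂ ℂ) (w n) v)) := by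
          rw [hg 0, pow_zero, one_apply_eq_self]
      _ = _ := by
          rw [Lp.toTemperedDistribution_apply]
          refine integral_congr_ae (Eventually.of_forall fun x => ?_)
          simp only [v, fourierSchwartz_pairing_fourierSchwartzInv, smul_eq_mul]
  have hle := eLpNorm_le_of_forall_integral_eq (kernelCLM d (w n)) (g 0) (g n) hrep
  have hk : ∫⁻ x, ‖kernelCLM d (w n) x‖ₑ =
      ENNReal.ofReal ‖(SchwartzMap.toLpCLM ℂ ℂ 1 (volume : Measure (Space d)))
        (kernelCLM d (w n))‖ := by
    rw [SchwartzMap.toLpCLM_apply, SchwartzMap.norm_toLp, ENNReal.ofReal_toReal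
      ((kernelCLM d (w n)).eLpNorm_lt_top 1 volume).ne, eLpNorm_one_eq_lintegral_enorm]
  rw [hk] at hle
  have hle' := ENNReal.toReal_mono
    (ENNReal.mul_ne_top ENNReal.ofReal_ne_top (Lp.memLp (g 0)).2.ne) hle
  rw [ENNReal.toReal_mul, ENNReal.toReal_ofReal (norm_nonneg _), ← Lp.norm_def,
    ← Lp.norm_def] at hle'
  calc ‖g n‖ ≤ _ := hle'
    _ ≤ (C * (M + (r - M)) ^ n) * ‖g 0‖ := by
        gcongr
        exact hC n
    _ = _ := by rw [add_sub_cancel]; ring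

end Estimates

/-! ### Passage to `n`-th roots. -/

section Limit

theorem eventually_mul_pow_lt {C a b c : ℝ} (ha : 0 ≤ a) (hab : a < b) (hc : 0 < c) :
    ∀ᶠ n : ℕ in atTop, C * a ^ n < c * b ^ n := by
  have hb : 0 < b := ha.trans_lt hab
  have h := (tendsto_pow_atTop_nhds_zero_of_lt_one (div_nonneg ha hb.le)
    ((div_lt_one hb).2 hab)).const_mul C
  rw [mul_zero] at h
  filter_upwards [h.eventually_lt_const hc] with n hn
  rwa [div_pow, ← mul_div_assoc, div_lt_iff₀ (pow_pos hb n)] at hn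

theorem eLpNorm_eq_ofReal_norm {d : ℕ} {p : ℝ≥0∞} (h : Lp ℂ p (volume : Measure (Space d))) :
    eLpNorm h p volume = ENNReal.ofReal ‖h‖ := by
  rw [Lp.norm_def, ENNReal.ofReal_toReal (Lp.memLp h).2.ne]

theorem eventually_pow_lt_norm_of_mem_dsupport {d : ℕ} {P : MvPolynomial (Fin d) ℂ} {p : ℝ≥0∞}
    [Fact (1 ≤ p)] {f : 𝓢'(Space d, ℂ)} {g : ℕ → Lp ℂ p (volume : Measure (Space d))}
    (hg : ∀ n : ℕ, Lp.toTemperedDistribution (g n) = ((diffOp P) ^ n) f)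
    {ξ : Space d} (hξ : ξ ∈ dsupport (fourierDist f)) {b : ℝ} (hb : 0 ≤ b)
    (hbξ : b < ‖symbol P ξ‖) :
    ∀ᶠ n : ℕ in atTop, b ^ n < ‖g n‖ := by
  obtain ⟨ρ, hbρ, hρ⟩ := exists_between hbξ
  have hρ0 : 0 < ρ := hb.trans_lt hbρ
  -- Intersecting with a ball makes the support of `φ` compact.
  obtain ⟨φ, hφs, hφ⟩ := (mem_dsupport_iff_forall_exists_ne (f := fourierDist f) ξ).1 hξ
    ({η | ρ < ‖symbol P η‖} ∩ Metric.ball ξ 1) ⟨hρ, Metric.mem_ball_self one_pos⟩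
    ((isOpen_lt continuous_const (contDiff_symbol P).continuous.norm).inter Metric.isOpen_ball)
  have hφc : HasCompactSupport φ := (isCompact_closedBall ξ 1).of_isClosed_subset
    (isClosed_tsupport _) ((hφs.trans Set.inter_subset_right).trans Metric.ball_subset_closedBall)
  obtain ⟨c, hbc, hcρ⟩ := exists_between hbρ
  have hc0 : 0 < c := hb.trans_lt hbc
  obtain ⟨C, hC0, hC⟩ := exists_norm_fourierDist_le hg hφc hρ0 (fun η hη => (hφs hη).1)
    (inv_strictAnti₀ hc0 hcρ)
  filter_upwards [eventually_mul_pow_lt (C := C) hb hbc (norm_pos_iff.2 hφ)] with n hn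
  by_contra! hle
  have h1 : ‖fourierDist f φ‖ * c ^ n ≤ C * ‖g n‖ := by
    calc _ ≤ (C * c⁻¹ ^ n * ‖g n‖) * c ^ n := by gcongr; exact hC n
      _ = C * ‖g n‖ * (c⁻¹ * c) ^ n := by rw [mul_pow]; ring
      _ = _ := by rw [inv_mul_cancel₀ hc0.ne', one_pow, mul_one]
  exact absurd (h1.trans (mul_le_mul_of_nonneg_left hle hC0)) (not_le.2 hn)

theorem tendsto_eLpNorm_rpow {d : ℕ} {P : MvPolynomial (Fin d) ℂ} {p : ℝ≥0∞} [Fact (1 ≤ p)]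
    {f : 𝓢'(Space d, ℂ)} {g : ℕ → Lp ℂ p (volume : Measure (Space d))}
    (hg : ∀ n : ℕ, Lp.toTemperedDistribution (g n) = ((diffOp P) ^ n) f)
    (h : IsCompact (dsupport (fourierDist f)) ∨
      ∀ R : ℝ, 0 ≤ R → IsCompact {ξ : Space d | ‖symbol P ξ‖ ≤ R}) :
    Tendsto (fun n : ℕ => (eLpNorm (g n) p volume) ^ (1 / (n : ℝ))) atTop
      (𝓝 (supRadius P (fourierDist f))) := by
  refine tendsto_order.2 ⟨fun b hb => ?_, fun b hb => ?_⟩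
  · obtain ⟨ξ, hbξ⟩ := lt_iSup_iff.1 hb
    obtain ⟨hξ, hbξ⟩ := lt_iSup_iff.1 hbξ
    have hbt : b ≠ ⊤ := hbξ.ne_top
    rw [← ofReal_norm, ← ENNReal.ofReal_toReal hbt] at hbξ
    have hbξ' := (ENNReal.ofReal_lt_ofReal_iff_of_nonneg ENNReal.toReal_nonneg).1 hbξ
    filter_upwards [eventually_pow_lt_norm_of_mem_dsupport hg hξ ENNReal.toReal_nonneg hbξ',
      eventually_gt_atTop 0] with n hn hn0
    have hn0' : (0 : ℝ) < n := by exact_mod_cast hn0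
    rw [one_div, ENNReal.lt_rpow_inv_iff hn0', ENNReal.rpow_natCast, eLpNorm_eq_ofReal_norm,
      ← ENNReal.ofReal_toReal hbt, ← ENNReal.ofReal_pow ENNReal.toReal_nonneg]
    exact (ENNReal.ofReal_lt_ofReal_iff_of_nonneg (by positivity)).2 hn
  -- An upper bound `b > R` exists only when `R` is finite. Between them, `M` bounds the symbol on
  -- the support, `r` leaves room for the `ε`-loss, and `b'` absorbs the constant `C` while staying
  -- finite even if `b = ∞`.
  · have hR : supRadius P (fourierDist f) ≠ ⊤ := hb.ne_top
    obtain ⟨M, hRM, hMb⟩ := exists_between hb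
    obtain ⟨r, hMr, hrb⟩ := exists_between hMb
    obtain ⟨b', hrb', hbb'⟩ := exists_between hrb
    have hMt := hMb.ne_top
    have hrt := hrb.ne_top
    have hbt := hbb'.ne_top
    have hsym : ∀ ξ ∈ dsupport (fourierDist f), ‖symbol P ξ‖ < M.toReal :=
      fun ξ hξ => by
        have h1 : ‖symbol P ξ‖ₑ ≤ supRadius P (fourierDist f) :=
          le_iSup₂ (f := fun ξ (_ : ξ ∈ dsupport (fourierDist f)) => ‖symbol P ξ‖ₑ)
            ξ hξ
        have h2 := (ENNReal.toReal_lt_toReal enorm_ne_top hMt).2 (h1.trans_lt hRM)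
        rwa [toReal_enorm] at h2
    have hK : IsCompact (dsupport (fourierDist f)) := by
      rcases h with h | h
      · exact h
      · exact (h M.toReal ENNReal.toReal_nonneg).of_isClosed_subset
          isClosed_dsupport fun ξ hξ => (hsym ξ hξ).le
    obtain ⟨C, hC0, hC⟩ := exists_norm_le_of_norm_symbol_lt hg hK ENNReal.toReal_nonneg hsym
      ((ENNReal.toReal_lt_toReal hMt hrt).2 hMr)
    filter_upwards [eventually_mul_pow_lt (C := C) ENNReal.toReal_nonneg
      ((ENNReal.toReal_lt_toReal hrt hbt).2 hrb') one_pos, eventually_gt_atTop 0] with n hn hn0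
    have hn0' : (0 : ℝ) < n := by exact_mod_cast hn0
    refine lt_trans ?_ hbb'
    rw [one_div, ENNReal.rpow_inv_lt_iff hn0', ENNReal.rpow_natCast, eLpNorm_eq_ofReal_norm,
      ← ENNReal.ofReal_toReal hbt, ← ENNReal.ofReal_pow ENNReal.toReal_nonneg]
    rw [one_mul] at hn
    exact (ENNReal.ofReal_lt_ofReal_iff_of_nonneg (norm_nonneg _)).2 ((hC n).trans_lt hn)

end Limit

end RealPaleyWiener

theorem mainTheorem2 {d : ℕ} (P : MvPolynomial (Fin d) ℂ) (p : ℝ≥0∞) [Fact (1 ≤ p)]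
    (f : 𝓢'(RealPaleyWiener.Space d, ℂ))
    (g : ℕ → Lp ℂ p (volume : Measure (RealPaleyWiener.Space d)))
    -- `P(∂)^n f` is (represented by) the `L^p` function `g n`, for every `n ≥ 0`
    (hg : ∀ n : ℕ, Lp.toTemperedDistribution (g n) = ((RealPaleyWiener.diffOp P) ^ n) f)
    (h : IsCompact (Distribution.dsupport (RealPaleyWiener.fourierDist f)) ∨
      ∀ R : ℝ, 0 ≤ R → IsCompact {ξ : RealPaleyWiener.Space d | ‖RealPaleyWiener.symbol P ξ‖ ≤ R}) :
    Tendsto (fun n : ℕ => (eLpNorm (g n) p volume) ^ (1 / (n : ℝ))) atTop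
      (𝓝 (RealPaleyWiener.supRadius P (RealPaleyWiener.fourierDist f))) :=
  RealPaleyWiener.tendsto_eLpNorm_rpow hg h
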